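/- There is a deterministic oracle random access machine and a polynomial $p$ such that the following holds. Let $G$ be a finite group of order $N$, given by its multiplication table, let $T$ be a finite tree with $n$ nodes, given by its adjacency matrix, and let $r$ be a node of $T$, its root. Let $\mathrm{Aut}(T,r)$ be the group of graph automorphisms of $T$ that fix $r$, and call $G$ representable on the rooted tree $(T,r)$ if there is a nontrivial homomorphism (one that is not constantly $1$) from $G$ to $\mathrm{Aut}(T,r)$. Given $(G,T,r)$ and an oracle that, for each $m$ with $1\le m\le n$, correctly answers whether $G$ has a nontrivial homomorphism to the symmetric group $S_m$ (its answers for other $m$ may be arbitrary), the machine halts after at most $p(N+n)$ steps and decides correctly whether $G$ is representable on $(T,r)$. Here the machine has finitely many registers and finitely many random access arrays holding natural numbers. One step is an assignment of a constant, an addition, a truncated subtraction, a read or write of an array cell, an oracle query about the number in a register, or a test whether a register is zero (for branching or looping). -/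

import Mathlib

namespace OracleRAM

/-- The store of a random access machine: number-valued registers, and arrays of numbers with
random access. A given program mentions only finitely many registers and arrays. -/
structure Store where
  reg : ℕ → ℕ
  arr : ℕ → ℕ → ℕ

/-- Set register `x` to the value `v`. -/
def Store.setReg (s : Store) (x v : ℕ) : Store :=
  { s with reg := Function.update s.reg x v }

/-- Set cell `i` of array `a` to the value `v`. -/
def Store.setArr (s : Store) (a i v : ℕ) : Store :=
  { s with arr := Function.update s.arr a (Function.update (s.arr a) i v) }

/-- Programs of an oracle random access machine. Here `x`, `y`, `z`, `i` are names of registers,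
`a` is the name of an array and `c` is a numeral. There is no multiplication, so that after `t`
unit-cost steps all numbers have `O(t)` more bits than the input numbers, and unit cost is
polynomially related to Turing machine time. -/
inductive Program : Type
  /-- `x := c` -/
  | const (x c : ℕ)
  /-- `x := y + z` -/
  | add (x y z : ℕ)
  /-- `x := max (y - z) 0` -/
  | sub (x y z : ℕ)
  /-- `x := a[i]` -/
  | load (x a i : ℕ)
  /-- `a[i] := x` -/
  | store (a i x : ℕ)
  /-- ask the oracle about the number in `y`; `x := 1` if it answers yes, `x := 0` otherwise -/
  | query (x y : ℕ)
  /-- first `p`, then `q` -/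
  | seq (p q : Program)
  /-- `if x ≠ 0 then p else q` -/
  | cond (x : ℕ) (p q : Program)
  /-- `while x ≠ 0 do p` -/
  | loop (x : ℕ) (p : Program)

/-- `Run O p s t s'`: with oracle `O`, the program `p` started in the store `s` halts in the store
`s'` after exactly `t` steps. Every instruction, every oracle query and every test of a register
is one step. -/
inductive Run (O : ℕ → Bool) : Program → Store → ℕ → Store → Prop
  | const (x c : ℕ) (s : Store) : Run O (.const x c) s 1 (s.setReg x c)
  | add (x y z : ℕ) (s : Store) : Run O (.add x y z) s 1 (s.setReg x (s.reg y + s.reg z))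
  | sub (x y z : ℕ) (s : Store) : Run O (.sub x y z) s 1 (s.setReg x (s.reg y - s.reg z))
  | load (x a i : ℕ) (s : Store) : Run O (.load x a i) s 1 (s.setReg x (s.arr a (s.reg i)))
  | store (a i x : ℕ) (s : Store) : Run O (.store a i x) s 1 (s.setArr a (s.reg i) (s.reg x))
  | query (x y : ℕ) (s : Store) :
      Run O (.query x y) s 1 (s.setReg x (if O (s.reg y) = true then 1 else 0))
  | seq {p q : Program} {s s' s'' : Store} {t t' : ℕ} :
      Run O p s t s' → Run O q s' t' s'' → Run O (.seq p q) s (t + t') s''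
  | cond_true {x : ℕ} {p q : Program} {s s' : Store} {t : ℕ} :
      s.reg x ≠ 0 → Run O p s t s' → Run O (.cond x p q) s (t + 1) s'
  | cond_false {x : ℕ} {p q : Program} {s s' : Store} {t : ℕ} :
      s.reg x = 0 → Run O q s t s' → Run O (.cond x p q) s (t + 1) s'
  | loop_done {x : ℕ} {p : Program} {s : Store} :
      s.reg x = 0 → Run O (.loop x p) s 1 s
  | loop_step {x : ℕ} {p : Program} {s s' s'' : Store} {t t' : ℕ} :
      s.reg x ≠ 0 → Run O p s t s' → Run O (.loop x p) s' t' s'' →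
        Run O (.loop x p) s (t + 1 + t') s''

end OracleRAM

namespace GroupRep

/-- The automorphism group of the tree `T` with root `r`: the graph automorphisms that fix `r`. -/
def RootedAut {V : Type*} (T : SimpleGraph V) (r : V) : Subgroup (T ≃g T) where
  carrier := {φ | φ r = r}
  one_mem' := rfl
  mul_mem' := by
    intro φ ψ hφ hψ
    change φ (ψ r) = r
    rw [show ψ r = r from hψ]
    exact hφ
  inv_mem' := by
    intro φ hφ
    change φ.symm r = r
    rw [RelIso.symm_apply_eq]
    exact (show φ r = r from hφ).symm

/-- `G` is representable on the rooted tree: it has a nontrivial homomorphism to the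
automorphism group. -/
def RepresentableOn (G : Type*) [Group G] {V : Type*} (T : SimpleGraph V) (r : V) : Prop :=
  ∃ ρ : G →* RootedAut T r, ∃ g : G, ρ g ≠ 1

/-- `G` has a nontrivial homomorphism to the symmetric group `S_m`. -/
def HasNontrivialPermRep (G : Type*) [Group G] (m : ℕ) : Prop :=
  ∃ ρ : G →* Equiv.Perm (Fin m), ∃ g : G, ρ g ≠ 1

/-- The multiplication table, in row-major order, of a group of order `N` whose elements are
numbered `0, …, N - 1` by `e`: cell `i * N + j` holds the number of the product of the elements
numbered `i` and `j`. -/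
def mulTable {G : Type*} [Group G] {N : ℕ} (e : G ≃ Fin N) (k : ℕ) : ℕ :=
  if h : k < N * N then
    (e (e.symm (Fin.divNat ⟨k, h⟩) * e.symm (Fin.modNat ⟨k, h⟩)) : ℕ)
  else 0

open Classical in
/-- The adjacency matrix, in row-major order, of a graph with vertices `0, …, n - 1`: cell
`i * n + j` holds `1` if `i` and `j` are adjacent, `0` otherwise. -/
noncomputable def adjTable {n : ℕ} (T : SimpleGraph (Fin n)) (k : ℕ) : ℕ :=
  if h : k < n * n then
    (if T.Adj (Fin.divNat ⟨k, h⟩) (Fin.modNat ⟨k, h⟩) then 1 else 0)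
  else 0

/-- The initial store: the order of the group, the number of vertices and the root are in
registers 0, 1, 2, the multiplication table in array 0 and the adjacency matrix in array 1;
everything else is 0. -/
noncomputable def inputStore {G : Type*} [Group G] {N n : ℕ} (e : G ≃ Fin N)
    (T : SimpleGraph (Fin n)) (r : Fin n) : OracleRAM.Store where
  reg x := if x = 0 then N else if x = 1 then n else if x = 2 then (r : ℕ) else 0
  arr a := if a = 0 then mulTable e else if a = 1 then adjTable T else fun _ => 0

end GroupRep

/-! Colour refinement from the partition isolating the root is stable after `n - 1` rounds. Then `G`
is representable iff, for some edge from `v` to `x`, it acts nontrivially on the set of neighbours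
of `v` coloured like `x` (`representableOn_iff`), so one query per ordered adjacent pair suffices.
If `G` acts nontrivially on the tree, take a moved vertex of least depth. All of `G` fixes its
parent and preserves colours, hence permutes its siblings of the same colour, nontrivially
(`exists_hasNontrivialPermRep`). Conversely, equally coloured siblings have isomorphic subtrees, and
numbering the equally coloured children of each vertex makes the choice of isomorphisms coherent:
the full symmetric group of such a class acts on the tree (`IsEquitable.exists_hom`). For the
machine, `Exp` is a language with bounded sums, and `Exp.run_compile` yields correctness and
polynomial cost together. What remains is to evaluate expressions that tabulate the refinement and
count accepted pairs. -/

namespace GroupRep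

/-! ### Colour refinement and its stabilisation -/

section Refinement

variable {V : Type*} [Fintype V] (T : SimpleGraph V) (r : V)

open Classical in
/-- The number of neighbours of `u` that `E` relates to `w`. -/
noncomputable def nbrCount (E : V → V → Prop) (u w : V) : ℕ :=
  (Finset.univ.filter fun x => T.Adj u x ∧ E x w).card

/-- Colour refinement of `T`, started from the partition that singles out `r`: two vertices are
related by `refinement T r k` if they have the same colour after `k` rounds. -/
def refinement : ℕ → V → V → Prop
  | 0, u, v => (u = r ↔ v = r)
  | k + 1, u, v => refinement k u v ∧
      ∀ w, nbrCount T (refinement k) u w = nbrCount T (refinement k) v w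

theorem refinement_equivalence (k : ℕ) : Equivalence (refinement T r k) := by
  induction k with
  | zero =>
    exact ⟨fun _ => Iff.rfl, fun h => Iff.symm h, fun h₁ h₂ => Iff.trans h₁ h₂⟩
  | succ k ih =>
    exact ⟨fun u => ⟨ih.refl u, fun _ => rfl⟩, fun h => ⟨ih.symm h.1, fun w => (h.2 w).symm⟩,
      fun h₁ h₂ => ⟨ih.trans h₁.1 h₂.1, fun w => (h₁.2 w).trans (h₂.2 w)⟩⟩

theorem eq_root_of_refinement {k : ℕ} {u : V} (h : refinement T r k u r) : u = r := by
  induction k with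
  | zero => exact (h : u = r ↔ r = r).2 rfl
  | succ k ih => exact ih h.1

/-- Automorphisms that fix `r` preserve the colours of every round. -/
theorem refinement_map (φ : T ≃g T) (hφ : φ r = r) (k : ℕ) (u : V) :
    refinement T r k (φ u) u := by
  induction k generalizing u with
  | zero =>
    change φ u = r ↔ u = r
    exact ⟨fun h => φ.injective (h.trans hφ.symm), fun h => h ▸ hφ⟩
  | succ k ih =>
    refine ⟨ih u, fun w => ?_⟩
    have hE := refinement_equivalence T r k
    unfold nbrCount
    symm
    refine Finset.card_bij (fun x _ => φ x) ?_ (fun _ _ _ _ h => φ.injective h) ?_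
    · intro x hx
      simp only [Finset.mem_filter, Finset.mem_univ, true_and] at hx ⊢
      exact ⟨φ.map_adj_iff.2 hx.1, hE.trans (ih x) hx.2⟩
    · intro y hy
      simp only [Finset.mem_filter, Finset.mem_univ, true_and] at hy
      obtain ⟨x, rfl⟩ := φ.surjective y
      refine ⟨x, ?_, rfl⟩
      simp only [Finset.mem_filter, Finset.mem_univ, true_and]
      exact ⟨φ.map_adj_iff.1 hy.1, hE.trans (hE.symm (ih x)) hy.2⟩

/-- The partition of round `k`. -/
def refinementSetoid (k : ℕ) : Setoid V := ⟨refinement T r k, refinement_equivalence T r k⟩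

/-- A round that changes the partition is preceded by enough colour splittings. -/
theorem lt_card_quotient_of_ne {k : ℕ} (h : refinement T r (k + 1) ≠ refinement T r k) :
    k + 1 < Nat.card (Quotient (refinementSetoid T r (k + 1))) := by
  -- A changing round strictly refines the partition, so it creates at least one new class.
  have key : ∀ j, refinement T r (j + 1) ≠ refinement T r j →
      Nat.card (Quotient (refinementSetoid T r j)) <
        Nat.card (Quotient (refinementSetoid T r (j + 1))) := by
    classical
    intro j hj
    rw [Nat.card_eq_fintype_card, Nat.card_eq_fintype_card]
    refine Fintype.card_lt_of_surjective_not_injective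
      (Quotient.map' (s₁ := refinementSetoid T r (j + 1)) (s₂ := refinementSetoid T r j)
        id fun _ _ h => h.1) ?_ ?_
    · rintro ⟨x⟩
      exact ⟨⟦x⟧, rfl⟩
    · intro hinj
      apply hj
      funext u v
      apply propext
      refine ⟨fun h => h.1, fun h => ?_⟩
      exact Quotient.exact (s := refinementSetoid T r (j + 1))
        (@hinj ⟦u⟧ ⟦v⟧ (Quotient.sound (s := refinementSetoid T r j) h))
  induction k with
  | zero =>
    have h0 : 0 < Nat.card (Quotient (refinementSetoid T r 0)) := by
      have : Nonempty (Quotient (refinementSetoid T r 0)) := ⟨⟦r⟧⟩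
      exact Nat.card_pos
    have := key 0 h
    omega
  | succ k ih =>
    -- Each round is determined by the previous one, so once nothing changes, nothing changes later.
    have hk : refinement T r (k + 1) ≠ refinement T r k := by
      intro he
      apply h
      funext u v
      change (refinement T r (k + 1) u v ∧ ∀ w, _ = _) = _
      rw [he]
      exact congrFun (congrFun he u) v
    have := key _ h
    have := ih hk
    omega

theorem refinement_stable {k : ℕ} (hk : Fintype.card V ≤ k + 1) :
    refinement T r (k + 1) = refinement T r k := by
  by_contra h
  have h₁ := lt_card_quotient_of_ne T r h
  have h₂ := Nat.card_le_card_of_surjective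
    (Quotient.mk (refinementSetoid T r (k + 1))) Quotient.mk_surjective
  rw [Nat.card_eq_fintype_card (α := V)] at h₂
  omega

end Refinement

/-! ### Parents in a rooted tree -/

section Parent

variable {V : Type*} (T : SimpleGraph V) (r : V)

open Classical in
/-- The parent of `z` in the tree `T` with root `r`. -/
noncomputable def parent (z : V) : V :=
  if h : ∃ p, T.Adj p z ∧ T.dist r z = T.dist r p + 1 then h.choose else z

variable {T r}

theorem exists_adj_dist_eq (hT : T.IsTree) {z : V} (hz : z ≠ r) :
    ∃ p, T.Adj p z ∧ T.dist r z = T.dist r p + 1 := by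
  obtain ⟨p, hp⟩ := hT.connected.exists_walk_length_eq_dist r z
  have hnil : ¬ p.Nil := fun h => hz h.eq.symm
  refine ⟨p.penultimate, p.adj_penultimate hnil, ?_⟩
  have h₁ : T.dist r p.penultimate ≤ p.dropLast.length := SimpleGraph.dist_le _
  have h₂ : p.dropLast.length + 1 = p.length := by
    simpa using p.length_dropLast_add_one hnil
  rcases hT.dist_eq_dist_add_one_of_adj r (p.adj_penultimate hnil) with h | h <;> omega

/-- Geodesics to `p` and to `q`, prolonged to `z`, are paths with the same ends, hence equal, and so
are their penultimate vertices. -/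
theorem eq_of_adj_of_dist_eq (hT : T.IsTree) {p q z : V} (hp : T.Adj p z) (hq : T.Adj q z)
    (hdp : T.dist r z = T.dist r p + 1) (hdq : T.dist r z = T.dist r q + 1) : p = q := by
  have key : ∀ a, T.Adj a z → T.dist r z = T.dist r a + 1 →
      ∃ w : T.Walk r z, w.IsPath ∧ w.penultimate = a := by
    intro a ha hd
    obtain ⟨w, hw, hl⟩ := hT.connected.exists_path_of_dist r a
    refine ⟨w.concat ha, ?_, by simp⟩
    apply SimpleGraph.Walk.isPath_of_length_eq_dist
    simp [hl, hd]
  obtain ⟨w₁, h₁, rfl⟩ := key p hp hdp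
  obtain ⟨w₂, h₂, rfl⟩ := key q hq hdq
  rw [(hT.existsUnique_path r z).unique h₁ h₂]

theorem parent_adj (hT : T.IsTree) {z : V} (hz : z ≠ r) : T.Adj (parent T r z) z := by
  have h := exists_adj_dist_eq hT hz
  rw [parent, dif_pos h]
  exact h.choose_spec.1

theorem dist_parent (hT : T.IsTree) {z : V} (hz : z ≠ r) :
    T.dist r z = T.dist r (parent T r z) + 1 := by
  have h := exists_adj_dist_eq hT hz
  rw [parent, dif_pos h]
  exact h.choose_spec.2

theorem parent_eq (hT : T.IsTree) {p z : V} (hp : T.Adj p z)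
    (hd : T.dist r z = T.dist r p + 1) : parent T r z = p := by
  have hz : z ≠ r := by
    rintro rfl
    simp at hd
  exact eq_of_adj_of_dist_eq hT (parent_adj hT hz) hp (dist_parent hT hz) hd

end Parent

end GroupRep

namespace GroupRep

/-! ### Extending a permutation of siblings downwards -/

section Extend

variable {V : Type*} {T : SimpleGraph V} {r : V}

open Classical in
/-- Extends a permutation `σ` of a set of siblings downwards, by means of the counterparts `tr`;
vertices that are not below these siblings are fixed if `tr` respects this. -/
noncomputable def extendPerm (T : SimpleGraph V) (r : V) (tr : V → V → V) {C : V → Prop}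
    (σ : Equiv.Perm {y // C y}) (z : V) : V :=
  if hC : C z then σ ⟨z, hC⟩
  -- In a tree this guard fails only at the root; it ensures termination in any graph.
  else if _h : T.dist r (parent T r z) < T.dist r z then
    tr z (extendPerm T r tr σ (parent T r z))
  else z
termination_by T.dist r z

theorem extendPerm_of_mem (tr : V → V → V) {C : V → Prop} (σ : Equiv.Perm {y // C y}) {z : V}
    (hz : C z) : extendPerm T r tr σ z = σ ⟨z, hz⟩ := by
  rw [extendPerm, dif_pos hz]

theorem extendPerm_of_notMem (hT : T.IsTree) (tr : V → V → V) {C : V → Prop}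
    (σ : Equiv.Perm {y // C y}) {z : V} (hz : ¬ C z) (hr : z ≠ r) :
    extendPerm T r tr σ z = tr z (extendPerm T r tr σ (parent T r z)) := by
  rw [extendPerm, dif_neg hz, dif_pos (by have := dist_parent hT hr; omega)]

theorem extendPerm_root (tr : V → V → V) {C : V → Prop} (σ : Equiv.Perm {y // C y})
    (hr : ¬ C r) : extendPerm T r tr σ r = r := by
  rw [extendPerm, dif_neg hr, dif_neg (by simp)]

/-- Induction from the root downwards. -/
theorem tree_induction (hT : T.IsTree) {P : V → Prop} (root : P r)
    (step : ∀ z, z ≠ r → P (parent T r z) → P z) (z : V) : P z := by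
  induction h : T.dist r z generalizing z with
  | zero =>
    rw [← (hT.connected.dist_eq_zero_iff).1 h]
    exact root
  | succ d ih =>
    have hz : z ≠ r := by
      rintro rfl
      simp at h
    exact step z hz (ih _ (by have := dist_parent hT hz; omega))

end Extend

/-! ### Equitable partitions and the action of sibling permutations -/

section Equitable

variable {V : Type*} [Fintype V] {T : SimpleGraph V} {r : V} {E : V → V → Prop}

/-- An equivalence relation on the vertices in which the root is alone in its class and related
vertices have equally many neighbours in each class. -/
structure IsEquitable (T : SimpleGraph V) (r : V) (E : V → V → Prop) : Prop where
  equiv : Equivalence E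
  root : ∀ {u}, E u r → u = r
  count : ∀ {u v}, E u v → ∀ w, nbrCount T E u w = nbrCount T E v w

theorem refinement_isEquitable (T : SimpleGraph V) (r : V) :
    IsEquitable T r (refinement T r (Fintype.card V - 1)) where
  equiv := refinement_equivalence T r _
  root := eq_root_of_refinement T r
  count {u v} h := by
    rw [← refinement_stable T r (k := Fintype.card V - 1) (by omega)] at h
    exact h.2

theorem IsEquitable.exists_adj (hE : IsEquitable T r E) {u v w : V} (h : E u v)
    (hw : T.Adj u w) : ∃ x, T.Adj v x ∧ E x w := by
  classical
  have h₁ : 0 < nbrCount T E u w :=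
    Finset.card_pos.2 ⟨w, by simp [hw, hE.equiv.refl w]⟩
  rw [hE.count h] at h₁
  obtain ⟨x, hx⟩ := Finset.card_pos.1 h₁
  exact ⟨x, by simpa using hx⟩

/-- The parent of `u` has a related vertex next to `v`, so the depth of `v` is bounded by induction
down to the root, which is alone in its class. Symmetry gives equality. -/
theorem IsEquitable.dist_eq (hE : IsEquitable T r E) (hT : T.IsTree) {u v : V} (h : E u v) :
    T.dist r u = T.dist r v := by
  have key : ∀ d u v, E u v → T.dist r u = d → T.dist r v ≤ d := by
    intro d
    induction d with
    | zero =>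
      intro u v h hd
      have : r = u := (hT.connected.dist_eq_zero_iff).1 hd
      subst this
      rw [hE.root (hE.equiv.symm h)]
      simp
    | succ d ih =>
      intro u v h hd
      have hu : u ≠ r := by
        rintro rfl
        simp at hd
      obtain ⟨x, hx, hxE⟩ := hE.exists_adj h (parent_adj hT hu).symm
      have h₁ := ih _ x (hE.equiv.symm hxE) (by have := dist_parent hT hu; omega)
      rcases hT.dist_eq_dist_add_one_of_adj r hx with h | h <;> omega
  exact le_antisymm (key _ _ _ (hE.equiv.symm h) rfl) (key _ _ _ h rfl)

theorem IsEquitable.parent_eq_of_adj (hE : IsEquitable T r E) (hT : T.IsTree) {q z z' : V}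
    (hz : z ≠ r) (hq : E q (parent T r z)) (ha : T.Adj q z') (h : E z' z) :
    parent T r z' = q := by
  apply parent_eq hT ha
  rw [hE.dist_eq hT h, hE.dist_eq hT hq, dist_parent hT hz]

/-- Siblings of the same class can be numbered consecutively, so that every child of a vertex
has exactly one counterpart below every related vertex. -/
theorem IsEquitable.exists_label (hE : IsEquitable T r E) (hT : T.IsTree) :
    ∃ l : V → ℕ, ∀ z, z ≠ r → ∀ q, E q (parent T r z) →
      ∃! z', T.Adj q z' ∧ E z' z ∧ l z' = l z := by
  classical
  let S : Setoid V := ⟨E, hE.equiv⟩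
  -- A fixed representative ensures that all members of a sibling class are labelled by the same
  -- bijection.
  let rep : V → V := fun z => (Quotient.mk S z).out
  have hrep : ∀ z, E z (rep z) := fun z => hE.equiv.symm (Quotient.mk_out (s := S) z)
  have hrep' : ∀ z z', E z z' → rep z = rep z' := fun z z' h => by
    change (Quotient.mk S z).out = (Quotient.mk S z').out
    rw [Quotient.sound (s := S) h]
  have hcard : ∀ p w, Fintype.card {y // T.Adj p y ∧ E y w} = nbrCount T E p w := fun p w =>
    Fintype.card_subtype _
  let f : ∀ p w, {y // T.Adj p y ∧ E y w} ≃ Fin (nbrCount T E p w) :=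
    fun p w => Fintype.equivFinOfCardEq (hcard p w)
  let l : V → ℕ := fun z =>
    if h : T.Adj (parent T r z) z ∧ E z (rep z) then f (parent T r z) (rep z) ⟨z, h⟩ else 0
  have hl : ∀ p w z (h : T.Adj p z ∧ E z w), parent T r z = p → rep z = w →
      l z = f p w ⟨z, h⟩ := by
    rintro p w z h rfl rfl
    exact dif_pos h
  refine ⟨l, fun z hz q hq => ?_⟩
  have hlz := hl _ _ z ⟨parent_adj hT hz, hrep z⟩ rfl rfl
  -- Equitability makes the class equally large below `q` and below the parent of `z`, so the label
  -- is in range.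
  have hlt : l z < nbrCount T E q (rep z) := by
    rw [hE.count hq, hlz]
    exact Fin.isLt _
  have hlab : ∀ z' (ha : T.Adj q z') (h : E z' z),
      l z' = f q (rep z) ⟨z', ha, hE.equiv.trans h (hrep z)⟩ := fun z' ha h =>
    hl _ _ z' _ (hE.parent_eq_of_adj hT hz hq ha h) (hrep' _ _ h)
  refine ⟨((f q (rep z)).symm ⟨l z, hlt⟩ : V), ?_, ?_⟩
  · have hy := ((f q (rep z)).symm ⟨l z, hlt⟩).2
    have hyz := hE.equiv.trans hy.2 (hE.equiv.symm (hrep z))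
    refine ⟨hy.1, hyz, ?_⟩
    rw [hlab _ hy.1 hyz]
    simp
  · rintro z' ⟨ha, h, hll⟩
    have : (f q (rep z)) ⟨z', ha, hE.equiv.trans h (hrep z)⟩ = ⟨l z, hlt⟩ := by
      apply Fin.ext
      rw [← hlab z' ha h, hll]
    rw [← this, Equiv.symm_apply_apply]

/-- The permutations of a class of siblings act on the rooted tree. -/
theorem IsEquitable.exists_hom (hE : IsEquitable T r E) (hT : T.IsTree) (v x : V)
    (hd : T.dist r x = T.dist r v + 1) :
    ∃ F : Equiv.Perm {y // T.Adj v y ∧ E y x} →* RootedAut T r,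
      ∀ σ (y : {y // T.Adj v y ∧ E y x}), (F σ).1 (y : V) = σ y := by
  obtain ⟨l, hl⟩ := hE.exists_label hT
  -- `tr z q` is the counterpart of `z` below `q`: the child with the class and label of `z`.
  choose! tr htr huniq using hl
  set C : V → Prop := fun y => T.Adj v y ∧ E y x with hC
  have hCd : ∀ {y}, C y → T.dist r y = T.dist r v + 1 := fun h => (hE.dist_eq hT h.2).trans hd
  have hCr : ¬ C r := fun h => by simpa using hCd h
  have hCne : ∀ {y}, C y → y ≠ r := fun h hy => hCr (hy ▸ h)
  have hCpar : ∀ {y}, C y → parent T r y = v := fun h => parent_eq hT h.1 (hCd h)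
  set f : Equiv.Perm {y // C y} → V → V := fun σ => extendPerm T r tr σ with hf
  have fC : ∀ σ z (hz : C z), f σ z = σ ⟨z, hz⟩ := fun σ z hz => extendPerm_of_mem tr σ hz
  have fN : ∀ σ z, ¬ C z → z ≠ r → f σ z = tr z (f σ (parent T r z)) := fun σ z hz hr =>
    extendPerm_of_notMem hT tr σ hz hr
  have fr : ∀ σ, f σ r = r := fun σ => extendPerm_root tr σ hCr
  have fE : ∀ σ z, E (f σ z) z := by
    intro σ
    refine tree_induction hT (by rw [fr]; exact hE.equiv.refl r) fun z hz ih => ?_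
    by_cases hzC : C z
    · rw [fC σ z hzC]
      exact hE.equiv.trans (σ ⟨z, hzC⟩).2.2 (hE.equiv.symm hzC.2)
    · rw [fN σ z hzC hz]
      exact (htr z hz _ ih).2.1
  have ffix : ∀ σ z, ¬ C z → f σ (parent T r z) = parent T r z → f σ z = z := by
    intro σ z hzC h
    by_cases hz : z = r
    · rw [hz, fr]
    · rw [fN σ z hzC hz, h]
      exact (huniq z hz _ (hE.equiv.refl _) z ⟨parent_adj hT hz, hE.equiv.refl _, rfl⟩).symm
  have flow : ∀ σ z, T.dist r z ≤ T.dist r v → f σ z = z := by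
    intro σ
    refine tree_induction hT (fun _ => fr σ) fun z hz ih hzd => ?_
    refine ffix σ z (fun h => ?_) (ih ?_)
    · have := hCd h
      omega
    · have := dist_parent hT hz
      omega
  have fpar : ∀ σ z, z ≠ r → parent T r (f σ z) = f σ (parent T r z) := by
    intro σ z hz
    by_cases hzC : C z
    · rw [fC σ z hzC, hCpar hzC, hCpar (σ ⟨z, hzC⟩).2, flow σ v le_rfl]
    · rw [fN σ z hzC hz]
      have := htr z hz _ (fE σ (parent T r z))
      exact hE.parent_eq_of_adj hT hz (fE σ _) this.1 this.2.1
  have fne : ∀ σ z, z ≠ r → f σ z ≠ r := fun σ z hz h =>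
    hz (hE.root (h ▸ hE.equiv.symm (fE σ z)))
  have fone : ∀ z, f 1 z = z := by
    refine tree_induction hT (fr 1) fun z hz ih => ?_
    by_cases hzC : C z
    · rw [fC 1 z hzC]
      rfl
    · exact ffix 1 z hzC ih
  -- Outside `C` both sides are children of the same vertex with the class and label of `z`, so
  -- uniqueness of counterparts identifies them.
  have fmul : ∀ σ τ z, f (σ * τ) z = f σ (f τ z) := by
    intro σ τ
    refine tree_induction hT (by rw [fr, fr, fr]) fun z hz ih => ?_
    by_cases hzC : C z
    · rw [fC _ z hzC, fC τ z hzC, fC σ _ (τ ⟨z, hzC⟩).2]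
      rfl
    -- At the depth of `C`, vertices outside `C` are fixed, so none of them enters `C`.
    · have hw : ¬ C (f τ z) := by
        intro hw
        have h₁ := dist_parent hT hz
        have h₂ := hE.dist_eq hT (fE τ z)
        have h₃ := hCd hw
        have h₄ := flow τ (parent T r z) (by omega)
        rw [ffix τ z hzC h₄] at hw
        exact hzC hw
      rw [fN _ z hzC hz, fN σ _ hw (fne τ z hz), fpar τ z hz, ← ih]
      symm
      have hτ := htr z hz _ (fE τ (parent T r z))
      rw [← fN τ z hzC hz] at hτ
      have hq : E (f (σ * τ) (parent T r z)) (parent T r (f τ z)) := by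
        rw [fpar τ z hz]
        exact hE.equiv.trans (fE _ _) (hE.equiv.symm (fE _ _))
      have hs := htr (f τ z) (fne τ z hz) _ hq
      exact huniq z hz _ (fE _ _) _
        ⟨hs.1, hE.equiv.trans hs.2.1 (fE τ z), hs.2.2.trans hτ.2.2⟩
  have fadj : ∀ σ a b, T.Adj a b → T.Adj (f σ a) (f σ b) := by
    have key : ∀ σ a b, T.Adj a b → T.dist r b = T.dist r a + 1 → T.Adj (f σ a) (f σ b) := by
      intro σ a b hab hd
      have hb : b ≠ r := by
        rintro rfl
        simp at hd
      have := parent_adj hT (fne σ b hb)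
      rwa [fpar σ b hb, parent_eq hT hab hd] at this
    intro σ a b hab
    rcases hT.dist_eq_dist_add_one_of_adj r hab with h | h
    · exact (key σ b a hab.symm h).symm
    · exact key σ a b hab h
  have finv : ∀ σ z, f σ⁻¹ (f σ z) = z := fun σ z => by rw [← fmul, inv_mul_cancel, fone]
  have finv' : ∀ σ z, f σ (f σ⁻¹ z) = z := fun σ z => by rw [← fmul, mul_inv_cancel, fone]
  let F : Equiv.Perm {y // C y} → RootedAut T r := fun σ =>
    ⟨⟨⟨f σ, f σ⁻¹, finv σ, finv' σ⟩, by
      intro a b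
      refine ⟨fun h => ?_, fadj σ a b⟩
      have := fadj σ⁻¹ _ _ h
      simpa only [Equiv.coe_fn_mk, finv] using this⟩, fr σ⟩
  refine ⟨⟨⟨F, ?_⟩, ?_⟩, ?_⟩
  · apply Subtype.ext
    apply RelIso.ext
    exact fone
  · intro σ τ
    apply Subtype.ext
    apply RelIso.ext
    exact fmul σ τ
  · intro σ y
    exact fC σ y y.2

end Equitable

/-! ### The criterion for representability -/

section Criterion

variable {V : Type*} [Fintype V] {T : SimpleGraph V} {r : V}

theorem hasNontrivialPermRep_iff (G : Type*) [Group G] {α : Type*} {m : ℕ} (e : α ≃ Fin m) :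
    HasNontrivialPermRep G m ↔ ∃ ρ : G →* Equiv.Perm α, ∃ g, ρ g ≠ 1 := by
  constructor
  · rintro ⟨ρ, g, hg⟩
    refine ⟨(e.symm.permCongrHom : _ →* _).comp ρ, g, fun h => hg ?_⟩
    exact e.symm.permCongrHom.injective (h.trans (map_one _).symm)
  · rintro ⟨ρ, g, hg⟩
    refine ⟨(e.permCongrHom : _ →* _).comp ρ, g, fun h => hg ?_⟩
    exact e.permCongrHom.injective (h.trans (map_one _).symm)

theorem representableOn_of_hasNontrivialPermRep {G : Type*} [Group G] {E : V → V → Prop}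
    (hE : IsEquitable T r E) (hT : T.IsTree) {v x : V} (hvx : T.Adj v x)
    (h : HasNontrivialPermRep G (nbrCount T E v x)) : RepresentableOn G T r := by
  classical
  obtain ⟨ρ, g, hg⟩ := (hasNontrivialPermRep_iff G
    (Fintype.equivFinOfCardEq (α := {y // T.Adj v y ∧ E y x}) (Fintype.card_subtype _))).1 h
  obtain ⟨y, hy⟩ : ∃ y, ρ g y ≠ y := by
    by_contra! hc
    exact hg (Equiv.ext hc)
  have hd : T.dist r x = T.dist r v + 1 := by
    rcases hT.dist_eq_dist_add_one_of_adj r hvx with h | h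
    -- If `x` is the parent of `v`, its class among the neighbours of `v` is a singleton and nothing
    -- can move.
    · refine absurd (Subtype.ext ?_) hy
      have key : ∀ z : {y // T.Adj v y ∧ E y x}, (z : V) = x := fun z =>
        eq_of_adj_of_dist_eq (r := r) hT z.2.1.symm hvx.symm
          (by rw [h, hE.dist_eq hT z.2.2]) h
      rw [key, key]
    · exact h
  obtain ⟨F, hF⟩ := hE.exists_hom hT v x hd
  refine ⟨F.comp ρ, g, fun h1 => hy (Subtype.ext ?_)⟩
  rw [← hF, show F (ρ g) = 1 from h1]
  rfl

/-- Automorphisms respect the colours of every round, so any `k` will do; stability matters only for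
the converse. -/
theorem exists_hasNontrivialPermRep {G : Type*} [Group G] (hT : T.IsTree)
    (h : RepresentableOn G T r) (k : ℕ) :
    ∃ v x, T.Adj v x ∧ HasNontrivialPermRep G (nbrCount T (refinement T r k) v x) := by
  classical
  obtain ⟨ρ, g, hg⟩ := h
  -- Indexing by depth lets `Nat.find` select a moved vertex closest to the root.
  have hmoved : ∃ d, ∃ x, T.dist r x = d ∧ ∃ g, (ρ g).1 x ≠ x := by
    by_contra! hc
    exact hg (Subtype.ext (RelIso.ext fun x => hc _ x rfl g))
  obtain ⟨x, hxd, g, hgx⟩ := Nat.find_spec hmoved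
  have hx : x ≠ r := by
    rintro rfl
    exact hgx (ρ g).2
  have hfix : ∀ g, (ρ g).1 (parent T r x) = parent T r x := by
    intro g
    by_contra hc
    refine Nat.find_min hmoved ?_ ⟨parent T r x, rfl, g, hc⟩
    have := dist_parent hT hx
    omega
  have hE := refinement_equivalence T r k
  refine ⟨parent T r x, x, parent_adj hT hx, ?_⟩
  let C : V → Prop := fun y => T.Adj (parent T r x) y ∧ refinement T r k y x
  refine (hasNontrivialPermRep_iff G
    (Fintype.equivFinOfCardEq (α := {y // C y}) (Fintype.card_subtype _))).2 ?_
  have hmem : ∀ g y, C ((ρ g).1 y) ↔ C y := by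
    intro g y
    have hm := refinement_map T r (ρ g).1 (ρ g).2 k y
    refine and_congr ?_ ⟨hE.trans (hE.symm hm), hE.trans hm⟩
    conv_lhs => rw [← hfix g]
    exact (ρ g).1.map_adj_iff
  refine ⟨⟨⟨fun g => Equiv.Perm.subtypePerm (ρ g).1.toEquiv (hmem g), ?_⟩, ?_⟩, g, fun h1 => hgx ?_⟩
  · ext y
    simp only [map_one]
    rfl
  · intro a b
    ext y
    simp only [map_mul]
    rfl
  · exact congrArg Subtype.val
      (Equiv.congr_fun h1 ⟨x, parent_adj hT hx, hE.refl x⟩)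

theorem representableOn_iff (G : Type*) [Group G] (hT : T.IsTree) :
    RepresentableOn G T r ↔ ∃ v x, T.Adj v x ∧ HasNontrivialPermRep G
      (nbrCount T (refinement T r (Fintype.card V - 1)) v x) :=
  ⟨fun h => exists_hasNontrivialPermRep hT h _, fun ⟨_, _, hvx, h⟩ =>
    representableOn_of_hasNontrivialPermRep (refinement_isEquitable T r) hT hvx h⟩

end Criterion

end GroupRep

/-! ### Loops and compiled expressions with running times -/

namespace OracleRAM

@[simp]
theorem Store.setReg_reg (s : Store) (x v y : ℕ) :
    (s.setReg x v).reg y = if y = x then v else s.reg y := by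
  simp [Store.setReg, Function.update_apply]

@[simp]
theorem Store.setReg_arr (s : Store) (x v : ℕ) : (s.setReg x v).arr = s.arr := rfl

@[simp]
theorem Store.setArr_reg (s : Store) (a i v : ℕ) : (s.setArr a i v).reg = s.reg := rfl

@[simp]
theorem Store.setArr_arr (s : Store) (a i v b j : ℕ) :
    (s.setArr a i v).arr b j = if b = a ∧ j = i then v else s.arr b j := by
  by_cases h : b = a
  · subst h
    simp [Store.setArr, Function.update_apply]
  · simp [Store.setArr, h]

/-- Repeat `body` for all values of register `i` below the value of register `1`. The registers
`i + 1` and `i + 2` hold the number of remaining rounds and the constant `1`. -/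
def forLoop (i : ℕ) (body : Program) : Program :=
  .seq (.const i 0) (.seq (.const (i + 1) 0) (.seq (.add (i + 1) (i + 1) 1)
    (.seq (.const (i + 2) 1)
      (.loop (i + 1) (.seq body (.seq (.add i i (i + 2)) (.sub (i + 1) (i + 1) (i + 2))))))))

/-- A loop rule: the invariant ignores the three control registers and the body restores them. Each
round adds a test, an increment and a decrement to the body; the `5` is the set-up and the last
test. -/
theorem run_forLoop {O : ℕ → Bool} {n i c : ℕ} {body : Program} (I : ℕ → Store → Prop)
    (hi : 2 ≤ i)
    (hI : ∀ j s x v, i ≤ x → x ≤ i + 2 → I j s → I j (s.setReg x v))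
    (hbody : ∀ j < n, ∀ s, I j s → s.reg i = j → ∃ t s', Run O body s t s' ∧ t ≤ c ∧
      I (j + 1) s' ∧ ∀ x, i ≤ x → x ≤ i + 2 → s'.reg x = s.reg x)
    (s : Store) (hn : s.reg 1 = n) (h0 : I 0 s) :
    ∃ t s', Run O (forLoop i body) s t s' ∧ t ≤ n * (c + 3) + 5 ∧ I n s' := by
  have main : ∀ m j s, j + m = n → s.reg i = j → s.reg (i + 1) = m → s.reg (i + 2) = 1 → I j s →
      ∃ t s', Run O (.loop (i + 1)
        (.seq body (.seq (.add i i (i + 2)) (.sub (i + 1) (i + 1) (i + 2))))) s t s' ∧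
        t ≤ m * (c + 3) + 1 ∧ I n s' := by
    intro m
    induction m with
    | zero =>
      intro j s hj _ hm _ h
      obtain rfl : j = n := by omega
      exact ⟨1, s, .loop_done hm, by simp, h⟩
    | succ m ih =>
      intro j s hj hij hm h1 h
      obtain ⟨t, s₁, hrun, ht, hI₁, hx⟩ := hbody j (by omega) s h hij
      have r0 := hx i le_rfl (by omega)
      have r1 := hx (i + 1) (by omega) (by omega)
      have r2 := hx (i + 2) (by omega) le_rfl
      obtain ⟨t', s', hrun', ht', hI'⟩ := ih (j + 1)
        ((s₁.setReg i (s₁.reg i + s₁.reg (i + 2))).setReg (i + 1)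
          ((s₁.setReg i (s₁.reg i + s₁.reg (i + 2))).reg (i + 1) -
            (s₁.setReg i (s₁.reg i + s₁.reg (i + 2))).reg (i + 2)))
        (by omega) (by simp [r0, r2, h1, hij]) (by simp [r1, r2, h1, hm])
        (by simp [r2, h1])
        (hI _ _ _ _ (by omega) (by omega) (hI _ _ _ _ le_rfl (by omega) hI₁))
      refine ⟨_, s', .loop_step (by omega)
        (.seq hrun (.seq (.add _ _ _ _) (.sub _ _ _ _))) hrun', ?_, hI'⟩
      have : (m + 1) * (c + 3) = m * (c + 3) + (c + 3) := by ring
      omega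
  obtain ⟨t, s', hrun, ht, hI'⟩ := main n 0
    ((((s.setReg i 0).setReg (i + 1) 0).setReg (i + 1)
      (((s.setReg i 0).setReg (i + 1) 0).reg (i + 1) +
        ((s.setReg i 0).setReg (i + 1) 0).reg 1)).setReg (i + 2) 1)
    (by omega) (by simp) (by
      have h₁ : 1 ≠ i := by omega
      have h₂ : i ≠ 0 := by omega
      simp [h₁, h₂, hn]) (by simp)
    (hI _ _ _ _ (by omega) le_rfl (hI _ _ _ _ (by omega) (by omega)
      (hI _ _ _ _ (by omega) (by omega) (hI _ _ _ _ le_rfl (by omega) h0))))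
  exact ⟨_, s', .seq (.const _ _ _) (.seq (.const _ _ _) (.seq (.add _ _ _ _)
    (.seq (.const _ _ _) hrun))), by omega, hI'⟩

/-- Arithmetic expressions without side effects. The bound variable of `sum f` is a register, whose
name is passed to `f`, and runs through the numbers below the value of register `1`. -/
inductive Exp : Type
  | reg (x : ℕ)
  | const (c : ℕ)
  | add (e₁ e₂ : Exp)
  | sub (e₁ e₂ : Exp)
  | load (a : ℕ) (e : Exp)
  | query (e : Exp)
  | ite (e e₁ e₂ : Exp)
  | sum (f : ℕ → Exp)

namespace Exp

/-- A program that writes the value of an expression to register `K` and changes no register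
below `K`. -/
def compile : Exp → ℕ → Program
  | .reg x, K => .seq (.const K 0) (.add K K x)
  | .const c, K => .const K c
  | .add e₁ e₂, K => .seq (e₁.compile K) (.seq (e₂.compile (K + 1)) (.add K K (K + 1)))
  | .sub e₁ e₂, K => .seq (e₁.compile K) (.seq (e₂.compile (K + 1)) (.sub K K (K + 1)))
  | .load a e, K => .seq (e.compile K) (.load K a K)
  | .query e, K => .seq (e.compile K) (.query K K)
  | .ite e e₁ e₂, K => .seq (e.compile K) (.cond K (e₁.compile K) (e₂.compile K))
  -- The loop controls occupy `K` to `K + 2` and the accumulator `K + 3`, so the body is compiled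
  -- from `K + 4`.
  | .sum f, K => .seq (.const (K + 3) 0)
      (.seq (forLoop K (.seq ((f K).compile (K + 4)) (.add (K + 3) (K + 3) (K + 4))))
        (.seq (.const K 0) (.add K K (K + 3))))

/-- The value of an expression compiled to register `K`. -/
def eval (O : ℕ → Bool) : Exp → ℕ → Store → ℕ
  | .reg x, _, s => s.reg x
  | .const c, _, _ => c
  | .add e₁ e₂, K, s => e₁.eval O K s + e₂.eval O (K + 1) s
  | .sub e₁ e₂, K, s => e₁.eval O K s - e₂.eval O (K + 1) s
  | .load a e, K, s => s.arr a (e.eval O K s)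
  | .query e, K, s => if O (e.eval O K s) = true then 1 else 0
  | .ite e e₁ e₂, K, s => if e.eval O K s ≠ 0 then e₁.eval O K s else e₂.eval O K s
  | .sum f, K, s => ∑ i ∈ Finset.range (s.reg 1), (f K).eval O (K + 4) (s.setReg K i)

/-- The free variables of an expression compiled to register `K` belong to `S`. -/
def ClosedAt : Exp → (ℕ → Prop) → ℕ → Prop
  | .reg x, S, _ => S x
  | .const _, _, _ => True
  | .add e₁ e₂, S, K => e₁.ClosedAt S K ∧ e₂.ClosedAt S (K + 1)
  | .sub e₁ e₂, S, K => e₁.ClosedAt S K ∧ e₂.ClosedAt S (K + 1)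
  | .load _ e, S, K => e.ClosedAt S K
  | .query e, S, K => e.ClosedAt S K
  | .ite e e₁ e₂, S, K => e.ClosedAt S K ∧ e₁.ClosedAt S K ∧ e₂.ClosedAt S K
  | .sum f, S, K => (f K).ClosedAt (fun x => S x ∨ x = K) (K + 4)

/-- A bound on the running time of a compiled expression, as a polynomial in the value of
register `1`. -/
noncomputable def cost : Exp → ℕ → Polynomial ℕ
  | .reg _, _ => 2
  | .const _, _ => 1
  | .add e₁ e₂, K => e₁.cost K + e₂.cost (K + 1) + 1
  | .sub e₁ e₂, K => e₁.cost K + e₂.cost (K + 1) + 1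
  | .load _ e, K => e.cost K + 1
  | .query e, K => e.cost K + 1
  | .ite e e₁ e₂, K => e.cost K + e₁.cost K + e₂.cost K + 1
  | .sum f, K => Polynomial.X * ((f K).cost (K + 4) + 4) + 8

/-- Allows a subexpression to be evaluated after others have overwritten scratch registers. Register
`1` belongs to `S` because every sum reads its range there. -/
theorem eval_congr (O : ℕ → Bool) (e : Exp) {S : ℕ → Prop} {K : ℕ} (h1 : S 1)
    (he : e.ClosedAt S K) {s s' : Store} (hr : ∀ x, S x → s'.reg x = s.reg x)
    (ha : s'.arr = s.arr) : e.eval O K s' = e.eval O K s := by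
  induction e generalizing S K s s' with
  | reg x => exact hr x he
  | const c => rfl
  | add e₁ e₂ ih₁ ih₂ => simp only [eval, ih₁ h1 he.1 hr ha, ih₂ h1 he.2 hr ha]
  | sub e₁ e₂ ih₁ ih₂ => simp only [eval, ih₁ h1 he.1 hr ha, ih₂ h1 he.2 hr ha]
  | load a e ih => simp only [eval, ih h1 he hr ha, ha]
  | query e ih => simp only [eval, ih h1 he hr ha]
  | ite e e₁ e₂ ih ih₁ ih₂ =>
    simp only [eval, ih h1 he.1 hr ha, ih₁ h1 he.2.1 hr ha, ih₂ h1 he.2.2 hr ha]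
  | sum f ih =>
    simp only [eval, hr 1 h1]
    refine Finset.sum_congr rfl fun i _ => ih K (.inl h1) he ?_ ha
    rintro x hx
    rw [Store.setReg_reg, Store.setReg_reg]
    split_ifs with h
    · rfl
    · exact hr x (hx.resolve_right h)

theorem run_compile (O : ℕ → Bool) (e : Exp) {S : ℕ → Prop} {K : ℕ} (h1 : S 1)
    (hS : ∀ x, S x → x < K) (he : e.ClosedAt S K) (s : Store) :
    ∃ t s', Run O (e.compile K) s t s' ∧ t ≤ (e.cost K).eval (s.reg 1) ∧
      s'.reg K = e.eval O K s ∧ (∀ x < K, s'.reg x = s.reg x) ∧ s'.arr = s.arr := by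
  have hlt : ∀ {x K : ℕ}, x < K → x ≠ K := fun h => h.ne
  induction e generalizing S K s with
  | reg x =>
    have hx := hlt (hS x he)
    refine ⟨_, _, .seq (.const _ _ _) (.add _ _ _ _), by simp [cost], by simp [eval, hx],
      fun y hy => by simp [hlt hy], rfl⟩
  | const c =>
    exact ⟨_, _, .const _ _ _, by simp [cost], by simp [eval], fun y hy => by simp [hlt hy], rfl⟩
  | add e₁ e₂ ih₁ ih₂ =>
    obtain ⟨t₁, s₁, r₁, c₁, v₁, f₁, a₁⟩ := ih₁ h1 hS he.1 s
    obtain ⟨t₂, s₂, r₂, c₂, v₂, f₂, a₂⟩ :=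
      ih₂ h1 (fun x hx => (hS x hx).trans (lt_add_one K)) he.2 s₁
    rw [f₁ 1 (hS 1 h1)] at c₂
    rw [eval_congr O e₂ h1 he.2 (fun x hx => f₁ x (hS x hx)) a₁] at v₂
    refine ⟨_, _, .seq r₁ (.seq r₂ (.add _ _ _ _)), ?_, ?_, fun y hy => ?_, a₂.trans a₁⟩
    · simp only [cost, Polynomial.eval_add, Polynomial.eval_one]
      omega
    · simp [eval, v₂, f₂ K (lt_add_one K), v₁]
    · simp [hlt hy, f₂ y (by omega), f₁ y hy]
  | sub e₁ e₂ ih₁ ih₂ =>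
    obtain ⟨t₁, s₁, r₁, c₁, v₁, f₁, a₁⟩ := ih₁ h1 hS he.1 s
    obtain ⟨t₂, s₂, r₂, c₂, v₂, f₂, a₂⟩ :=
      ih₂ h1 (fun x hx => (hS x hx).trans (lt_add_one K)) he.2 s₁
    rw [f₁ 1 (hS 1 h1)] at c₂
    rw [eval_congr O e₂ h1 he.2 (fun x hx => f₁ x (hS x hx)) a₁] at v₂
    refine ⟨_, _, .seq r₁ (.seq r₂ (.sub _ _ _ _)), ?_, ?_, fun y hy => ?_, a₂.trans a₁⟩
    · simp only [cost, Polynomial.eval_add, Polynomial.eval_one]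
      omega
    · simp [eval, v₂, f₂ K (lt_add_one K), v₁]
    · simp [hlt hy, f₂ y (by omega), f₁ y hy]
  | load a e ih =>
    obtain ⟨t₁, s₁, r₁, c₁, v₁, f₁, a₁⟩ := ih h1 hS he s
    refine ⟨_, _, .seq r₁ (.load _ _ _ _), ?_, ?_, fun y hy => ?_, a₁⟩
    · simp only [cost, Polynomial.eval_add, Polynomial.eval_one]
      omega
    · simp [eval, v₁, a₁]
    · simp [hlt hy, f₁ y hy]
  | query e ih =>
    obtain ⟨t₁, s₁, r₁, c₁, v₁, f₁, a₁⟩ := ih h1 hS he s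
    refine ⟨_, _, .seq r₁ (.query _ _ _), ?_, ?_, fun y hy => ?_, a₁⟩
    · simp only [cost, Polynomial.eval_add, Polynomial.eval_one]
      omega
    · simp [eval, v₁]
    · simp [hlt hy, f₁ y hy]
  | ite e e₁ e₂ ih ih₁ ih₂ =>
    obtain ⟨t, s₁, r₁, c₁, v₁, f₁, a₁⟩ := ih h1 hS he.1 s
    obtain ⟨t₂, s₂, r₂, c₂, v₂, f₂, a₂⟩ := ih₁ h1 hS he.2.1 s₁
    obtain ⟨t₃, s₃, r₃, c₃, v₃, f₃, a₃⟩ := ih₂ h1 hS he.2.2 s₁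
    rw [f₁ 1 (hS 1 h1)] at c₂ c₃
    rw [eval_congr O e₁ h1 he.2.1 (fun x hx => f₁ x (hS x hx)) a₁] at v₂
    rw [eval_congr O e₂ h1 he.2.2 (fun x hx => f₁ x (hS x hx)) a₁] at v₃
    simp only [cost, Polynomial.eval_add, Polynomial.eval_one, eval]
    by_cases h : e.eval O K s = 0
    · refine ⟨_, _, .seq r₁ (.cond_false (v₁.trans h) r₃), by omega, ?_,
        fun y hy => (f₃ y hy).trans (f₁ y hy), a₃.trans a₁⟩
      rw [if_neg (by simp [h]), v₃]
    · refine ⟨_, _, .seq r₁ (.cond_true (fun h' => h (v₁.symm.trans h')) r₂), by omega, ?_,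
        fun y hy => (f₂ y hy).trans (f₁ y hy), a₂.trans a₁⟩
      rw [if_pos h, v₂]
  | sum f ih =>
    have hK : 1 < K := hS 1 h1
    let I : ℕ → Store → Prop := fun j s' =>
      s'.reg (K + 3) = ∑ i ∈ Finset.range j, (f K).eval O (K + 4) (s.setReg K i) ∧
        (∀ x < K, s'.reg x = s.reg x) ∧ s'.arr = s.arr
    obtain ⟨t, s', hr, ht, hv, hf, ha⟩ := run_forLoop (O := O) (n := s.reg 1) (i := K)
      (c := ((f K).cost (K + 4)).eval (s.reg 1) + 1)
      (body := .seq ((f K).compile (K + 4)) (.add (K + 3) (K + 3) (K + 4))) I hK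
      (by
        rintro j s' x v hx hx' ⟨hv, hf, ha⟩
        refine ⟨?_, fun y hy => ?_, ha⟩
        · rw [Store.setReg_reg, if_neg (by omega), hv]
        · rw [Store.setReg_reg, if_neg (by omega), hf y hy])
      (by
        rintro j _ s' ⟨hv, hf, ha⟩ hj
        obtain ⟨t, s₁, r₁, c₁, v₁, f₁, a₁⟩ := ih K (S := fun x => S x ∨ x = K) (.inl h1)
          (fun x hx => by
            rcases hx with hx | hx
            · exact (hS x hx).trans (by omega)
            · omega) he s'
        rw [hf 1 hK] at c₁
        rw [eval_congr O (f K) (S := fun x => S x ∨ x = K) (s := s.setReg K j) (.inl h1) he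
          (fun x hx => by
            rw [Store.setReg_reg]
            split_ifs with h
            · rw [h, hj]
            · exact hf x (hS x (hx.resolve_right h))) ha] at v₁
        refine ⟨_, _, .seq r₁ (.add _ _ _ _), by omega, ⟨?_, fun x hx => ?_, a₁.trans ha⟩,
          fun x hx hx' => ?_⟩
        · rw [Store.setReg_reg, if_pos rfl, v₁, f₁ (K + 3) (by omega), hv,
            Finset.sum_range_succ]
        · rw [Store.setReg_reg, if_neg (by omega), f₁ x (by omega), hf x hx]
        · rw [Store.setReg_reg, if_neg (by omega), f₁ x (by omega)])
      (s.setReg (K + 3) 0) (by rw [Store.setReg_reg, if_neg (by omega)])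
      ⟨by simp, fun x hx => by rw [Store.setReg_reg, if_neg (by omega)], rfl⟩
    refine ⟨_, _, .seq (.const _ _ _) (.seq hr (.seq (.const _ _ _) (.add _ _ _ _))), ?_, ?_,
      fun x hx => ?_, ha⟩
    · simp only [cost, Polynomial.eval_add, Polynomial.eval_mul, Polynomial.eval_X,
        Polynomial.eval_ofNat]
      change t ≤ s.reg 1 * (((f K).cost (K + 4)).eval (s.reg 1) + 4) + 5 at ht
      omega
    · simp [eval, hv]
    · simp [hlt hx, hf x hx]

end Exp

end OracleRAM

/-! ### The decision program and its correctness -/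

namespace GroupRep

open OracleRAM

/-- The index of cell `(k, u, v)` in an array of matrices with `n` rows and columns. -/
def cell (n k u v : ℕ) : ℕ := n * (n * k + u) + v

/-- The entry of the adjacency matrix at the vertices in registers `u` and `v`. -/
def adjExp (u v : ℕ) : Exp := .load 1 (.add (.sum fun _ => .reg u) (.reg v))

/-- The cell index for the numbers in registers `k`, `u` and `v`. -/
def cellExp (k u v : ℕ) : Exp :=
  .add (.sum fun _ => .add (.sum fun _ => .reg k) (.reg u)) (.reg v)

/-- The entry of array `2` at `u` and `v` in the matrix before matrix `k`. -/
def prevExp (k u v : ℕ) : Exp :=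
  .load 2 (.add (.sum fun _ => .add (.sum fun _ => .sub (.reg k) (.const 1)) (.reg u)) (.reg v))

/-- The number of neighbours of `u` that the matrix before matrix `k` relates to `w`. -/
def countExp (k u w : ℕ) : Exp := .sum fun x => .ite (adjExp u x) (prevExp k x w) (.const 0)

/-- A number that is zero if and only if the two expressions have equal values. -/
def neExp (e₁ e₂ : Exp) : Exp := .add (.sub e₁ e₂) (.sub e₂ e₁)

/-- The entry at `u` and `v` of the matrix of round `k` of colour refinement. -/
def roundExp (k u v : ℕ) : Exp :=
  .ite (.reg k)
    (.ite (prevExp k u v)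
      (.ite (.sum fun w => neExp (countExp k u w) (countExp k v w)) (.const 0) (.const 1))
      (.const 0))
    (.ite (neExp (.reg u) (.reg 2))
      (.ite (neExp (.reg v) (.reg 2)) (.const 1) (.const 0))
      (.ite (neExp (.reg v) (.reg 2)) (.const 0) (.const 1)))

/-- The number of adjacent pairs `(v, x)` such that the oracle accepts the number of neighbours of
`v` with the same final colour as `x`. -/
def answerExp : Exp :=
  .sum fun v => .sum fun x => .ite (adjExp v x) (.query (countExp 1 v x)) (.const 0)

/-- Compute one entry of the matrices of colour refinement. -/
def fillBody : Program :=
  .seq ((cellExp 3 6 9).compile 12) (.seq ((roundExp 3 6 9).compile 13) (.store 2 12 13))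

/-- Compute the matrices of colour refinement, then query the oracle. -/
def decisionProgram : Program :=
  .seq (forLoop 3 (forLoop 6 (forLoop 9 fillBody)))
    (.seq (answerExp.compile 3) (.seq (.const 0 0) (.add 0 0 3)))

section Eval

variable (O : ℕ → Bool) {K : ℕ} (s : Store)

/-- Summing a constant over the range `reg 1` replaces the missing multiplication; `hu` keeps the
bound variable from shadowing `u`. -/
theorem eval_adjExp {u v : ℕ} (hu : u < K) :
    (adjExp u v).eval O K s = s.arr 1 (s.reg 1 * s.reg u + s.reg v) := by
  simp [adjExp, Exp.eval, hu.ne]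

theorem eval_cellExp {k u v : ℕ} (hK : 1 < K) (hk : k < K) (hu : u < K) :
    (cellExp k u v).eval O K s = cell (s.reg 1) (s.reg k) (s.reg u) (s.reg v) := by
  have h₁ : k ≠ K + 4 := by omega
  simp [cellExp, cell, Exp.eval, hK.ne, hk.ne, hu.ne, h₁]

theorem eval_prevExp {k u v : ℕ} (hK : 1 < K) (hk : k < K) (hu : u < K) :
    (prevExp k u v).eval O K s = s.arr 2 (cell (s.reg 1) (s.reg k - 1) (s.reg u) (s.reg v)) := by
  have h₁ : k ≠ K + 4 := by omega
  simp [prevExp, cell, Exp.eval, hK.ne, hk.ne, hu.ne, h₁]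

/-- Two truncated differences vanish together only for equal numbers. Each operand is compiled
twice, at different registers, hence the quantified `K'`. -/
theorem eval_neExp_eq_zero {e₁ e₂ : Exp} {a b : ℕ} (h₁ : ∀ K', K ≤ K' → e₁.eval O K' s = a)
    (h₂ : ∀ K', K ≤ K' → e₂.eval O K' s = b) : (neExp e₁ e₂).eval O K s = 0 ↔ a = b := by
  simp only [neExp, Exp.eval]
  rw [h₁ K le_rfl, h₁ (K + 1 + 1) (by omega), h₂ (K + 1) (by omega)]
  omega

end Eval

section Correctness

variable {n : ℕ} (T : SimpleGraph (Fin n)) (r : Fin n)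

theorem adjTable_apply (u v : Fin n) [Decidable (T.Adj u v)] :
    adjTable T (n * u + v) = if T.Adj u v then 1 else 0 := by
  have hlt : n * u + v < n * n := by
    have h : n * (u + 1) ≤ n * n := Nat.mul_le_mul_left n u.2
    have := v.2
    rw [Nat.mul_add] at h
    omega
  have h₁ : Fin.divNat ⟨n * u + v, hlt⟩ = u := by
    apply Fin.ext
    simp [Nat.mul_add_div u.pos, Nat.div_eq_of_lt v.2]
  have h₂ : Fin.modNat ⟨n * u + v, hlt⟩ = v := by
    apply Fin.ext
    simp [Nat.mod_eq_of_lt v.2]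
  rw [adjTable, dif_pos hlt, h₁, h₂]
  congr

theorem cell_inj {k k' : ℕ} {u u' v v' : Fin n} (h : cell n k u v = cell n k' u' v') :
    k = k' ∧ u = u' ∧ v = v' := by
  have key : ∀ {a b : ℕ} {x y : Fin n}, n * a + x = n * b + y → a = b ∧ x = y := by
    intro a b x y h
    have h₁ := congrArg (· / n) h
    have h₂ := congrArg (· % n) h
    simp only [Nat.mul_add_div x.pos, Nat.div_eq_of_lt x.2, Nat.div_eq_of_lt y.2,
      Nat.mul_add_mod, Nat.mod_eq_of_lt x.2, Nat.mod_eq_of_lt y.2] at h₁ h₂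
    exact ⟨h₁, Fin.ext h₂⟩
  obtain ⟨h₁, rfl⟩ := key h
  obtain ⟨h₂, rfl⟩ := key h₁
  exact ⟨h₂, rfl, rfl⟩

theorem cell_lt {k k' : ℕ} (hk : k < k') (u v : Fin n) : cell n k u v < cell n k' 0 0 := by
  have h₁ : n * (n * k + u + 1) ≤ n * (n * k') := by
    refine Nat.mul_le_mul_left n ?_
    have h : n * (k + 1) ≤ n * k' := Nat.mul_le_mul_left n hk
    have := u.2
    rw [Nat.mul_add] at h
    omega
  have := v.2
  rw [Nat.mul_add] at h₁
  simp only [cell, Nat.add_zero]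
  omega

open Classical in
/-- All cells of array `2` before cell `pos` hold the correct entries. -/
def Filled (pos : ℕ) (s : Store) : Prop :=
  ∀ k (u v : Fin n), cell n k u v < pos →
    s.arr 2 (cell n k u v) = if refinement T r k u v then 1 else 0

variable {T r}

theorem eval_countExp (O : ℕ → Bool) {K k u w : ℕ} {s : Store} {κ : ℕ} {a b : Fin n}
    (hK : 1 < K) (hk : k < K) (hu : u < K) (hw : w < K)
    (h1 : s.reg 1 = n) (hT : s.arr 1 = adjTable T) (hkκ : s.reg k = κ + 1)
    (hua : s.reg u = a) (hwb : s.reg w = b) (hs : Filled T r (cell n (κ + 1) 0 0) s) :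
    (countExp k u w).eval O K s = nbrCount T (refinement T r κ) a b := by
  classical
  simp only [countExp, Exp.eval, h1]
  rw [nbrCount, Finset.card_filter, Finset.sum_range]
  refine Finset.sum_congr rfl fun x _ => ?_
  rw [eval_adjExp _ _ (by omega), eval_prevExp _ _ (by omega) (by omega) (by omega)]
  simp only [Store.setReg_reg, Store.setReg_arr, hK.ne, hk.ne, hu.ne, hw.ne, if_true, if_false,
    h1, hT, hkκ, hua, hwb, adjTable_apply, Nat.add_sub_cancel]
  rw [hs κ x b (cell_lt (Nat.lt_succ_self κ) _ _)]
  by_cases hax : T.Adj a x <;> simp [hax]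

open Classical in
theorem eval_roundExp (O : ℕ → Bool) {K k u v : ℕ} {s : Store} {κ : ℕ} {a b : Fin n}
    (hK : 2 < K) (hk : k < K) (hu : u < K) (hv : v < K)
    (h1 : s.reg 1 = n) (h2 : s.reg 2 = r) (hT : s.arr 1 = adjTable T) (hkκ : s.reg k = κ)
    (hua : s.reg u = a) (hvb : s.reg v = b) (hs : Filled T r (cell n κ 0 0) s) :
    (roundExp k u v).eval O K s = if refinement T r κ a b then 1 else 0 := by
  rw [roundExp, Exp.eval]
  cases κ with
  | zero =>
    rw [if_neg (by simp [Exp.eval, hkκ])]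
    simp only [Exp.eval, ne_eq]
    have hroot : ∀ x (c : Fin n), s.reg x = c →
        ((neExp (.reg x) (.reg 2)).eval O K s = 0 ↔ c = r) := fun x c hx =>
      (eval_neExp_eq_zero O s (e₁ := .reg x) (e₂ := .reg 2) (fun _ _ => hx)
        (fun _ _ => h2)).trans Fin.val_inj
    simp only [hroot u a hua, hroot v b hvb, refinement]
    by_cases har : a = r <;> by_cases hbr : b = r <;> simp [har, hbr]
  | succ κ =>
    rw [if_pos (by simp [Exp.eval, hkκ]), Exp.eval,
      eval_prevExp _ _ (by omega) (by omega) (by omega)]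
    rw [h1, hkκ, hua, hvb, Nat.add_sub_cancel, hs κ a b (cell_lt (Nat.lt_succ_self κ) _ _)]
    by_cases hab : refinement T r κ a b
    swap
    · rw [if_neg (by simp [hab]), if_neg fun h => hab h.1]
      rfl
    rw [if_pos (by simp [hab]), Exp.eval]
    have hsum : (Exp.sum fun w => neExp (countExp k u w) (countExp k v w)).eval O K s = 0 ↔
        ∀ w, nbrCount T (refinement T r κ) a w = nbrCount T (refinement T r κ) b w := by
      rw [Exp.eval, h1, Finset.sum_range, Finset.sum_eq_zero_iff]
      simp only [Finset.mem_univ, true_imp_iff]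
      refine forall_congr' fun w => ?_
      have hc : ∀ K' x (c : Fin n), K + 4 ≤ K' → x < K → s.reg x = c →
          (countExp k x K).eval O K' (s.setReg K w) = nbrCount T (refinement T r κ) c w := by
        intro K' x c hK' hx hxc
        refine eval_countExp O (by omega) (by omega) (by omega) (by omega) ?_ hT ?_ ?_ ?_ hs
        · rw [Store.setReg_reg, if_neg (by omega), h1]
        · rw [Store.setReg_reg, if_neg (by omega), hkκ]
        · rw [Store.setReg_reg, if_neg (by omega), hxc]
        · rw [Store.setReg_reg, if_pos rfl]
      exact eval_neExp_eq_zero O _ (fun K' h => hc K' u a h hu hua)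
        (fun K' h => hc K' v b h hv hvb)
    by_cases hall : ∀ w, nbrCount T (refinement T r κ) a w = nbrCount T (refinement T r κ) b w
    · rw [if_neg (by simpa using hsum.2 hall), if_pos ⟨hab, hall⟩]
      rfl
    · rw [if_pos (fun h => hall (hsum.1 h)), if_neg fun h => hall h.2]
      rfl

/-- A bound on the running time of a loop in terms of a bound for its body. -/
noncomputable def loopCost (p : Polynomial ℕ) : Polynomial ℕ := Polynomial.X * (p + 3) + 5

theorem eval_loopCost (p : Polynomial ℕ) (n : ℕ) :
    (loopCost p).eval n = n * (p.eval n + 3) + 5 := by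
  simp [loopCost]

/-- A bound on the running time of `fillBody`. -/
noncomputable def fillCost : Polynomial ℕ :=
  (cellExp 3 6 9).cost 12 + (roundExp 3 6 9).cost 13 + 1

theorem run_fillBody (O : ℕ → Bool) {s : Store} {κ : ℕ} {a b : Fin n}
    (h1 : s.reg 1 = n) (h2 : s.reg 2 = r) (hT : s.arr 1 = adjTable T) (h3 : s.reg 3 = κ)
    (h6 : s.reg 6 = a) (h9 : s.reg 9 = b) (hs : Filled T r (cell n κ a b) s) :
    ∃ t s', Run O fillBody s t s' ∧ t ≤ fillCost.eval n ∧ (∀ x < 12, s'.reg x = s.reg x) ∧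
      s'.arr 1 = adjTable T ∧ Filled T r (cell n κ a (b + 1)) s' := by
  obtain ⟨t₁, s₁, r₁, c₁, v₁, f₁, a₁⟩ := (cellExp 3 6 9).run_compile O (K := 12)
    (S := fun x => x < 12) (by omega) (fun _ h => h) (by simp [cellExp, Exp.ClosedAt]) s
  obtain ⟨t₂, s₂, r₂, c₂, v₂, f₂, a₂⟩ := (roundExp 3 6 9).run_compile O (K := 13)
    (S := fun x => x < 12) (by omega) (fun _ h => h.trans (by omega))
    (by simp [roundExp, neExp, countExp, adjExp, prevExp, Exp.ClosedAt]) s₁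
  rw [eval_cellExp O s (by omega) (by omega) (by omega), h1, h3, h6, h9] at v₁
  -- An entry of round `κ` depends only on earlier matrices, which are complete.
  have hs₁ : Filled T r (cell n κ 0 0) s₁ := fun k u v h => by
    rw [a₁]
    exact hs k u v (h.trans_le (by simp only [cell]; gcongr <;> omega))
  rw [eval_roundExp O (r := r) (T := T) (κ := κ) (a := a) (b := b) (by omega) (by omega)
    (by omega) (by omega) (by rw [f₁ 1 (by omega), h1]) (by rw [f₁ 2 (by omega), h2])
    (by rw [a₁, hT]) (by rw [f₁ 3 (by omega), h3]) (by rw [f₁ 6 (by omega), h6])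
    (by rw [f₁ 9 (by omega), h9]) hs₁] at v₂
  refine ⟨_, _, .seq r₁ (.seq r₂ (.store _ _ _ _)), ?_, fun x hx => ?_, ?_, ?_⟩
  · rw [f₁ 1 (by omega), h1] at c₂
    rw [h1] at c₁
    simp only [fillCost, Polynomial.eval_add, Polynomial.eval_one]
    omega
  · rw [Store.setArr_reg, f₂ x (by omega), f₁ x hx]
  · funext j
    rw [Store.setArr_arr, if_neg (by simp), a₂, a₁, hT]
  · intro k u v h
    rw [Store.setArr_arr, v₂, f₂ 12 (by omega), v₁]
    by_cases he : cell n k u v = cell n κ a b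
    · rw [if_pos ⟨rfl, he⟩]
      obtain ⟨rfl, rfl, rfl⟩ := cell_inj he
      rfl
    · rw [if_neg fun h => he h.2, a₂, a₁]
      refine hs k u v ?_
      simp only [cell] at h he ⊢
      omega

theorem run_fillLoop_column (O : ℕ → Bool) {s : Store} {κ : ℕ} {a : Fin n}
    (h1 : s.reg 1 = n) (h2 : s.reg 2 = r) (hT : s.arr 1 = adjTable T) (h3 : s.reg 3 = κ)
    (h6 : s.reg 6 = a) (hs : Filled T r (cell n κ a 0) s) :
    ∃ t s', Run O (forLoop 9 fillBody) s t s' ∧ t ≤ (loopCost fillCost).eval n ∧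
      (∀ x < 9, s'.reg x = s.reg x) ∧ s'.arr 1 = adjTable T ∧
      Filled T r (cell n κ (a + 1) 0) s' := by
  rw [eval_loopCost]
  -- The end of a row is the start of the next, so the inner loop's final invariant is the outer
  -- loop's next one.
  have hpos : cell n κ (a + 1) 0 = cell n κ a n := by simp only [cell]; ring
  rw [hpos]
  refine run_forLoop (fun j s' => (∀ x < 9, s'.reg x = s.reg x) ∧ s'.arr 1 = adjTable T ∧
      Filled T r (cell n κ a j) s') (by omega) ?_ ?_ s h1 ⟨fun _ _ => rfl, hT, hs⟩
  · rintro j s' x v hx - ⟨hf, ha, hs'⟩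
    exact ⟨fun y hy => by rw [Store.setReg_reg, if_neg (by omega), hf y hy], ha, hs'⟩
  · rintro j hj s' ⟨hf, ha, hs'⟩ h9
    obtain ⟨t, s₁, r₁, c₁, f₁, a₁, hs₁⟩ := run_fillBody O (s := s') (κ := κ) (a := a)
      (b := ⟨j, hj⟩) (by rw [hf 1 (by omega), h1]) (by rw [hf 2 (by omega), h2]) ha
      (by rw [hf 3 (by omega), h3]) (by rw [hf 6 (by omega), h6]) h9 hs'
    exact ⟨t, s₁, r₁, c₁, ⟨fun x hx => (f₁ x (by omega)).trans (hf x hx), a₁, hs₁⟩,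
      fun x _ hx => f₁ x (by omega)⟩

theorem run_fillLoop_row (O : ℕ → Bool) {s : Store} {κ : ℕ}
    (h1 : s.reg 1 = n) (h2 : s.reg 2 = r) (hT : s.arr 1 = adjTable T) (h3 : s.reg 3 = κ)
    (hs : Filled T r (cell n κ 0 0) s) :
    ∃ t s', Run O (forLoop 6 (forLoop 9 fillBody)) s t s' ∧
      t ≤ (loopCost (loopCost fillCost)).eval n ∧
      (∀ x < 6, s'.reg x = s.reg x) ∧ s'.arr 1 = adjTable T ∧
      Filled T r (cell n (κ + 1) 0 0) s' := by
  rw [eval_loopCost]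
  have hpos : cell n (κ + 1) 0 0 = cell n κ n 0 := by simp only [cell]; ring
  rw [hpos]
  refine run_forLoop (fun j s' => (∀ x < 6, s'.reg x = s.reg x) ∧ s'.arr 1 = adjTable T ∧
      Filled T r (cell n κ j 0) s') (by omega) ?_ ?_ s h1 ⟨fun _ _ => rfl, hT, hs⟩
  · rintro j s' x v hx - ⟨hf, ha, hs'⟩
    exact ⟨fun y hy => by rw [Store.setReg_reg, if_neg (by omega), hf y hy], ha, hs'⟩
  · rintro j hj s' ⟨hf, ha, hs'⟩ h6
    obtain ⟨t, s₁, r₁, c₁, f₁, a₁, hs₁⟩ := run_fillLoop_column O (s := s') (κ := κ)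
      (a := ⟨j, hj⟩) (by rw [hf 1 (by omega), h1]) (by rw [hf 2 (by omega), h2]) ha
      (by rw [hf 3 (by omega), h3]) h6 hs'
    exact ⟨t, s₁, r₁, c₁, ⟨fun x hx => (f₁ x (by omega)).trans (hf x hx), a₁, hs₁⟩,
      fun x _ hx => f₁ x (by omega)⟩

theorem run_fillLoop (O : ℕ → Bool) {s : Store}
    (h1 : s.reg 1 = n) (h2 : s.reg 2 = r) (hT : s.arr 1 = adjTable T) :
    ∃ t s', Run O (forLoop 3 (forLoop 6 (forLoop 9 fillBody))) s t s' ∧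
      t ≤ (loopCost (loopCost (loopCost fillCost))).eval n ∧
      s'.reg 1 = n ∧ s'.arr 1 = adjTable T ∧ Filled T r (cell n n 0 0) s' := by
  rw [eval_loopCost]
  have main := run_forLoop (O := O) (n := n) (i := 3)
    (c := (loopCost (loopCost fillCost)).eval n) (body := forLoop 6 (forLoop 9 fillBody))
    (fun j s' => (∀ x < 3, s'.reg x = s.reg x) ∧ s'.arr 1 = adjTable T ∧
      Filled T r (cell n j 0 0) s') (by omega) ?_ ?_ s h1
    ⟨fun _ _ => rfl, hT, fun k u v h => by simp [cell] at h⟩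
  · obtain ⟨t, s', hr, ht, hf, ha, hs⟩ := main
    exact ⟨t, s', hr, ht, (hf 1 (by omega)).trans h1, ha, hs⟩
  · rintro j s' x v hx - ⟨hf, ha, hs'⟩
    exact ⟨fun y hy => by rw [Store.setReg_reg, if_neg (by omega), hf y hy], ha, hs'⟩
  · rintro j hj s' ⟨hf, ha, hs'⟩ h3
    obtain ⟨t, s₁, r₁, c₁, f₁, a₁, hs₁⟩ := run_fillLoop_row O (s := s') (κ := j)
      (by rw [hf 1 (by omega), h1]) (by rw [hf 2 (by omega), h2]) ha h3 hs'
    exact ⟨t, s₁, r₁, c₁, ⟨fun x hx => (f₁ x (by omega)).trans (hf x hx), a₁, hs₁⟩,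
      fun x _ hx => f₁ x (by omega)⟩

theorem eval_answerExp_ne_zero (O : ℕ → Bool) {s : Store} (h1 : s.reg 1 = n)
    (hT : s.arr 1 = adjTable T) (hs : Filled T r (cell n n 0 0) s) :
    answerExp.eval O 3 s ≠ 0 ↔
      ∃ v x, T.Adj v x ∧ O (nbrCount T (refinement T r (n - 1)) v x) = true := by
  classical
  have hn : n = n - 1 + 1 := by
    have := r.pos
    omega
  have hterm : ∀ v x : Fin n, (Exp.ite (adjExp 3 7) (.query (countExp 1 3 7)) (.const 0)).eval O 11
      ((s.setReg 3 v).setReg 7 x) ≠ 0 ↔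
        T.Adj v x ∧ O (nbrCount T (refinement T r (n - 1)) v x) = true := by
    intro v x
    -- Register `1` holds `n`; used as a round index it selects the preceding matrix `n - 1`, the
    -- stable one.
    have hcount := eval_countExp O (T := T) (r := r) (K := 11) (k := 1) (u := 3) (w := 7)
      (s := (s.setReg 3 v).setReg 7 x) (κ := n - 1) (a := v) (b := x) (by omega) (by omega)
      (by omega) (by omega) (by simp [h1]) hT (by simpa [h1] using hn) (by simp) (by simp)
      (by rw [← hn]; exact hs)
    simp only [Exp.eval]
    rw [eval_adjExp _ _ (by omega), hcount]
    simp only [Store.setReg_reg, Store.setReg_arr, hT]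
    norm_num
    rw [h1, adjTable_apply]
    simp
  rw [answerExp, Exp.eval, h1, Finset.sum_range, ne_eq, Finset.sum_eq_zero_iff]
  simp only [Finset.mem_univ, true_imp_iff, not_forall]
  refine exists_congr fun v => ?_
  rw [Exp.eval, Store.setReg_reg, if_neg (by omega), h1, Finset.sum_range,
    Finset.sum_eq_zero_iff]
  simp only [Finset.mem_univ, true_imp_iff, not_forall]
  exact exists_congr fun x => hterm v x

end Correctness

theorem eval_le_eval (p : Polynomial ℕ) {a b : ℕ} (h : a ≤ b) : p.eval a ≤ p.eval b := by
  rw [Polynomial.eval_eq_sum_range, Polynomial.eval_eq_sum_range]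
  gcongr

/-- A bound on the running time of `decisionProgram`. -/
noncomputable def decisionCost : Polynomial ℕ :=
  loopCost (loopCost (loopCost fillCost)) + answerExp.cost 3 + 2

theorem run_decisionProgram {n : ℕ} (T : SimpleGraph (Fin n)) (r : Fin n) (O : ℕ → Bool)
    {s : Store} (h1 : s.reg 1 = n) (h2 : s.reg 2 = r) (hT : s.arr 1 = adjTable T) :
    ∃ t s', Run O decisionProgram s t s' ∧ t ≤ decisionCost.eval n ∧
      (s'.reg 0 ≠ 0 ↔
        ∃ v x, T.Adj v x ∧ O (nbrCount T (refinement T r (n - 1)) v x) = true) := by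
  obtain ⟨t₁, s₁, r₁, c₁, h1₁, a₁, hs₁⟩ := run_fillLoop O h1 h2 hT
  obtain ⟨t₂, s₂, r₂, c₂, v₂, f₂, a₂⟩ := answerExp.run_compile O (K := 3)
    (S := fun x => x < 3) (by omega) (fun _ h => h)
    (by simp [answerExp, countExp, adjExp, prevExp, Exp.ClosedAt]) s₁
  refine ⟨_, _, .seq r₁ (.seq r₂ (.seq (.const _ _ _) (.add _ _ _ _))), ?_, ?_⟩
  · rw [h1₁] at c₂
    simp only [decisionCost, Polynomial.eval_add, Polynomial.eval_ofNat]
    omega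
  · simp only [Store.setReg_reg, if_true]
    norm_num only [if_false, zero_add]
    rw [v₂]
    exact eval_answerExp_ne_zero O h1₁ a₁ hs₁

/-- Since `x` counts itself, no query falls below the range in which the oracle is reliable. -/
theorem one_le_nbrCount {V : Type*} [Fintype V] {T : SimpleGraph V} {E : V → V → Prop}
    (hE : Equivalence E) {v x : V} (h : T.Adj v x) : 1 ≤ nbrCount T E v x := by
  classical
  exact Finset.card_pos.2 ⟨x, by simp [h, hE.refl x]⟩

end GroupRep

theorem mainTheorem4 :
    ∃ (P : OracleRAM.Program) (p : Polynomial ℕ),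
      ∀ (G : Type*) [Group G] (N n : ℕ) (e : G ≃ Fin N)
        (T : SimpleGraph (Fin n)) (_ : T.IsTree) (r : Fin n) (O : ℕ → Bool),
        (∀ m : ℕ, 1 ≤ m → m ≤ n → (O m = true ↔ GroupRep.HasNontrivialPermRep G m)) →
        ∃ (t : ℕ) (s : OracleRAM.Store),
          OracleRAM.Run O P (GroupRep.inputStore e T r) t s ∧
          t ≤ p.eval (N + n) ∧
          (s.reg 0 ≠ 0 ↔ GroupRep.RepresentableOn G T r) := by
  refine ⟨GroupRep.decisionProgram, GroupRep.decisionCost, ?_⟩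
  intro G _ N n e T hT r O hO
  obtain ⟨t, s, hr, ht, hs⟩ := GroupRep.run_decisionProgram T r O
    (s := GroupRep.inputStore e T r) rfl rfl rfl
  refine ⟨t, s, hr, ht.trans (GroupRep.eval_le_eval _ (Nat.le_add_left n N)), ?_⟩
  rw [hs, GroupRep.representableOn_iff G hT, Fintype.card_fin]
  refine exists_congr fun v => exists_congr fun x => and_congr_right fun hvx => hO _ ?_ ?_
  · exact GroupRep.one_le_nbrCount (GroupRep.refinement_equivalence T r _) hvx
  · exact (Finset.card_le_univ _).trans (Fintype.card_fin n).le
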